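/- All matroids are finite. For a matroid $M$ with ground set $E$ and rank function $r$, the characteristic polynomial is $$\chi_M(\lambda)=\sum_{F}\mu_M(\emptyset,F)\,\lambda^{r(E)-r(F)}$$ if $M$ is loopless, where the sum is over the flats $F$ of $M$ and $\mu_M$ is the Möbius function of the lattice of flats; if $M$ has a loop, $\chi_M=0$. A tree-decomposition of $M$ is a pair $(T,\tau)$ of a finite (non-empty) tree $T$ and an arbitrary map $\tau:E\to V(T)$. For a vertex $v$ of $T$, let $B_{1},\dots,B_{c}$ be the preimages under $\tau$ of the vertex sets of the components of $T-v$. The node width of $v$ is $r(E)-\sum_{j=1}^{c}\bigl(r(E)-r(E\setminus B_{j})\bigr)$, the width of $(T,\tau)$ is the maximum node width of its vertices, and the (Hliněný–Whittle) tree-width of $M$ is the minimum width of a tree-decomposition of $M$. **Theorem 1.3.** Let $q$ be a prime power and $k$ a positive integer. If $M$ is a $GF(q)$-representable matroid of tree-width at most $k$, then either $\chi_M$ is identically zero, or $\chi_M(\lambda)>0$ for all real $\lambda>q^{k-1}$. The bound is sharp: the projective geometry $PG(k-1,q)$ is $GF(q)$-representable, has tree-width exactly $k$, and its characteristic polynomial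 is not identically zero and has a root at $\lambda=q^{k-1}$. -/

import Mathlib

open Set

namespace Matroid

variable {α : Type*}

/-! ### Rank function and characteristic polynomial of a finite matroid -/

/-- The rank `r(X)` as a natural number (the rank function of Mathlib is `ℕ∞`-valued; for a finite
matroid it never takes the value `⊤`). -/
noncomputable def natRk (M : Matroid α) (X : Set α) : ℕ := (M.eRk X).toNat

/-- The flats of `M`, ordered by inclusion. -/
abbrev FlatSet (M : Matroid α) : Type _ := {F : Set α // M.IsFlat F}

instance finite_flatSet (M : Matroid α) [M.Finite] : Finite M.FlatSet :=
  (M.ground_finite.finite_subsets.subset fun _ hF ↦ hF.subset_ground : {F | M.IsFlat F}.Finite)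

open Classical in
noncomputable instance locallyFiniteOrder_flatSet (M : Matroid α) [M.Finite] :
    LocallyFiniteOrder M.FlatSet :=
  letI := Fintype.ofFinite M.FlatSet
  Fintype.toLocallyFiniteOrder

/-- In a loopless matroid, the empty set is a flat. -/
theorem isFlat_empty_of_loopless {M : Matroid α} (h : M.Loopless) : M.IsFlat ∅ := by
  rw [← h.loops_eq_empty]
  exact M.isFlat_closure ∅

open Classical in
/-- The characteristic polynomial
`χ_M(λ) = ∑_F μ(∅, F) λ ^ (r(E) - r(F))`, where the sum runs over the flats `F` of `M` and
`μ` is the Möbius function of the lattice of flats; it is zero when `M` has a loop. -/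
noncomputable def charPoly (M : Matroid α) [M.Finite] : Polynomial ℝ :=
  if h : M.Loopless then
    ∑ᶠ F : M.FlatSet,
      Polynomial.C (IncidenceAlgebra.mu ℝ (⟨∅, isFlat_empty_of_loopless h⟩ : M.FlatSet) F) *
        Polynomial.X ^ (M.natRk M.E - M.natRk F.1)
  else 0

/-! ### Representability -/

/-- `M` is representable over the field `K`: the elements of `M` can be labelled by the columns of
a matrix over `K` in such a way that a set of elements is independent in `M` exactly when the
family of the corresponding columns is linearly independent. -/
def IsRepresentable (M : Matroid α) (K : Type*) [Field K] : Prop :=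
  ∃ (n : ℕ) (v : α → Fin n → K), ∀ I : Set α, I ⊆ M.E → (M.Indep I ↔ LinearIndepOn K v I)

/-! ### Tree-width -/

/-- A tree-decomposition `(T, τ)` of a matroid: a finite tree `T` and an arbitrary map `τ` from the
elements to the vertices of `T` (only the values of `τ` on the ground set matter below). -/
structure TreeDecomp (M : Matroid α) where
  /-- the vertices of the tree -/
  V : Type
  finite_V : Finite V
  /-- the tree `T` -/
  T : SimpleGraph V
  isTree : T.IsTree
  /-- the map `τ` -/
  τ : α → V

namespace TreeDecomp

variable {M : Matroid α}

/-- The set of elements of `M` that `τ` maps into the component `C` of `T - v`. -/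
def displayed (D : M.TreeDecomp) (v : D.V)
    (C : (D.T.induce ({v}ᶜ : Set D.V)).ConnectedComponent) : Set α :=
  {e ∈ M.E | ∃ h : D.τ e ∈ ({v}ᶜ : Set D.V),
    (D.T.induce ({v}ᶜ : Set D.V)).connectedComponentMk ⟨D.τ e, h⟩ = C}

end TreeDecomp

/-- The rank defect `rd(B) = r(M) - r(E(M) - B)`. -/
noncomputable def rankDefect (M : Matroid α) (B : Set α) : ℤ :=
  (M.natRk M.E : ℤ) - M.natRk (M.E \ B)

/-- The node width of `v`: the rank of `M` minus the sum of the rank defects of the sets displayed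
by `v`, one for each component of `T - v`. -/
noncomputable def TreeDecomp.nodeWidth {M : Matroid α} (D : M.TreeDecomp) (v : D.V) : ℤ :=
  (M.natRk M.E : ℤ) -
    ∑ᶠ C : (D.T.induce ({v}ᶜ : Set D.V)).ConnectedComponent, M.rankDefect (D.displayed v C)

/-- The width of `(T, τ)`: the maximum node width (the tree is finite and not empty, so that the
supremum is a maximum). -/
noncomputable def TreeDecomp.width {M : Matroid α} (D : M.TreeDecomp) : ℤ :=
  ⨆ v : D.V, D.nodeWidth v

/-- The tree-width of `M`: the minimum width of a tree-decomposition of `M` (node widths of a finite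
matroid are nonnegative and there is a decomposition, so that the infimum is a minimum). -/
noncomputable def treeWidth (M : Matroid α) : ℤ :=
  sInf (Set.range fun D : M.TreeDecomp ↦ D.width)

/-! ### Projective geometries -/

/-- The projective geometry `PG(k - 1, K)` over a finite field `K`, a matroid of rank `k`: its
elements are the points of the projective space of `K ^ k`, that is, the lines through the origin,
and a set of points is independent when spanning vectors of these lines are linearly independent
(whichever spanning vectors are chosen). -/
noncomputable def projGeom (K : Type*) [Field K] [Finite K] (k : ℕ) :
    Matroid (Projectivization K (Fin k → K)) :=
  (IndepMatroid.ofFinite (E := Set.univ) Set.finite_univ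
    (fun I ↦ Projectivization.Independent (fun p : I ↦ (p : Projectivization K (Fin k → K))))
    (by
      rw [Projectivization.independent_iff]
      exact linearIndependent_empty_type)
    (by
      intro I J hJ hIJ
      rw [Projectivization.independent_iff] at hJ ⊢
      exact LinearIndepOn.mono (v := Projectivization.rep) (s := J) (t := I) hJ hIJ)
    (by
      intro I J hI hJ hlt
      rw [Projectivization.independent_iff] at hI hJ
      change LinearIndepOn K Projectivization.rep I at hI
      change LinearIndepOn K Projectivization.rep J at hJ
      by_contra! hcon
      have hspan : ∀ e ∈ J, Projectivization.rep e ∈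
          Submodule.span K (Projectivization.rep '' I) := by
        intro e he
        by_cases heI : e ∈ I
        · exact Submodule.subset_span (Set.mem_image_of_mem _ heI)
        · by_contra hns
          refine hcon e he heI ?_
          rw [Projectivization.independent_iff]
          exact hI.insert hns
      have hle : Submodule.span K (Projectivization.rep '' J) ≤
          Submodule.span K (Projectivization.rep '' I) := by
        rw [Submodule.span_le]
        rintro _ ⟨e, he, rfl⟩
        exact hspan e he
      have hrk := Submodule.finrank_mono hle
      have key : ∀ S : Set (Projectivization K (Fin k → K)),
          LinearIndepOn K Projectivization.rep S →
          Module.finrank K (Submodule.span K (Projectivization.rep '' S)) = S.ncard := by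
        intro S hS
        have := Fintype.ofFinite S
        have h := finrank_span_eq_card (R := K) (b := fun p : S ↦ Projectivization.rep p.1) hS
        rw [← Nat.card_eq_fintype_card, Nat.card_coe_set_eq] at h
        rw [← h, Set.image_eq_range]
      rw [key I hI, key J hJ] at hrk
      omega)
    (fun _ _ ↦ Set.subset_univ _)).matroid

end Matroid

/-! The proof is an induction by deletion and contraction, driven by small cocircuits. Let `D` be a
cocircuit with complementary hyperplane `H`, and rebuild `M` from `M|H` by adding `D` one element at
a time. The first element is a coloop and multiplies the value at `x` by `x - 1`. Each later one
subtracts the value of a contraction, which is at most the value of `M|H`. Hence `χ_M(x) ≥ (x - |D|)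
χ_{M|H}(x)`, positive when `|D| < x` (`subsetExpansion_pos`).

Node widths do not increase under minors, so it remains to find a cocircuit with at most `q^(k-1)`
elements in a simple non-empty matroid of width at most `k`. A smallest component with positive rank
defect leads to a node at which some set of rank at most `k` contains a cocircuit
(`exists_rank_le_of_minorNodeWidth_le`). Off its hyperplane, this cocircuit embeds in an affine
space with at most `q^(k-1)` points (`card_mul_card_sdiff_le`).

For sharpness, `χ(q^m)` counts `m`-tuples of linear forms without a common zero among the
represented elements (`subsetExpansion_natCard_pow`). Fewer than `k` forms on `K^k` have a common
nonzero zero, so `q^(k-1)` is a root for the projective geometry. Positivity then rules out a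
tree-width below `k`. -/

namespace Matroid

/-! ### Rank functions on finite sets. -/

/-- The rank functions of matroids, on the finite sets of elements. -/
structure IsRankFunction {α : Type*} [DecidableEq α] (r : Finset α → ℕ) : Prop where
  mono : ∀ {A B : Finset α}, A ⊆ B → r A ≤ r B
  submodular : ∀ A B : Finset α, r (A ∪ B) + r (A ∩ B) ≤ r A + r B
  insert_le : ∀ (e : α) (A : Finset α), r (insert e A) ≤ r A + 1

namespace IsRankFunction

variable {α : Type*} [DecidableEq α] {r : Finset α → ℕ}

/-- Diminishing returns: submodularity for `insert e A` and `B`, whose intersection contains `A`. -/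
theorem insert_add_le (hr : IsRankFunction r) (e : α) {A B : Finset α} (h : A ⊆ B) :
    r (insert e B) + r A ≤ r (insert e A) + r B := by
  have h1 := hr.submodular (insert e A) B
  rw [Finset.insert_union, Finset.union_eq_right.2 h] at h1
  have h2 : r A ≤ r (insert e A ∩ B) :=
    hr.mono (Finset.subset_inter (Finset.subset_insert _ _) h)
  omega

theorem insert_eq_of_subset (hr : IsRankFunction r) {e : α} {A B : Finset α} (h : A ⊆ B)
    (he : r (insert e A) = r A) : r (insert e B) = r B := by
  have h1 := hr.insert_add_le e h
  have h2 := hr.mono (Finset.subset_insert e B)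
  omega

theorem insert_eq_succ_of_subset (hr : IsRankFunction r) {e : α} {A B : Finset α} (h : A ⊆ B)
    (he : r B < r (insert e B)) : r (insert e A) = r A + 1 := by
  have h1 := hr.insert_add_le e h
  have h2 := hr.insert_le e A
  omega

end IsRankFunction

/-! ### Deletion-contraction and positivity from small cocircuits. -/

/-- The subset expansion of the characteristic polynomial, evaluated at `x`, of the minor on `E`
obtained by contracting `C`. -/
noncomputable def subsetExpansion {α : Type*} [DecidableEq α] (r : Finset α → ℕ) (E C : Finset α)
    (x : ℝ) : ℝ :=
  ∑ A ∈ E.powerset, (-1) ^ A.card * x ^ (r (E ∪ C) - r (A ∪ C))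

section SubsetExpansion

variable {α : Type*} [DecidableEq α] {r : Finset α → ℕ}

/-- The subsets are split by whether they contain `e`. The power of `x` is `x` for a coloop and `1`
otherwise, so one formula covers both cases. -/
theorem subsetExpansion_insert (hr : IsRankFunction r) {e : α} {E : Finset α} (he : e ∉ E)
    (C : Finset α) (x : ℝ) :
    subsetExpansion r (insert e E) C x =
      x ^ (r (insert e (E ∪ C)) - r (E ∪ C)) * subsetExpansion r E C x -
        subsetExpansion r E (insert e C) x := by
  unfold subsetExpansion
  rw [Finset.sum_powerset_insert he, Finset.mul_sum, sub_eq_add_neg, ← Finset.sum_neg_distrib]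
  congr 1
  · refine Finset.sum_congr rfl fun A hA ↦ ?_
    have h1 : r (A ∪ C) ≤ r (E ∪ C) :=
      hr.mono (Finset.union_subset_union_left (Finset.mem_powerset.1 hA))
    have h2 := hr.mono (Finset.subset_insert e (E ∪ C))
    rw [Finset.insert_union, mul_left_comm, ← pow_add]
    congr 2
    omega
  · refine Finset.sum_congr rfl fun A hA ↦ ?_
    have h1 : e ∉ A := fun h ↦ he (Finset.mem_powerset.1 hA h)
    rw [Finset.card_insert_of_notMem h1, Finset.insert_union, Finset.insert_union,
      Finset.union_insert, Finset.union_insert]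
    ring

/-- For a loop (`n = 0`) or a coloop (`n = 1`), contraction shifts all ranks equally and so agrees
with deletion. -/
theorem subsetExpansion_insert_right_eq {e : α} {E C : Finset α} {n : ℕ}
    (h : ∀ A ⊆ E, r (insert e (A ∪ C)) = r (A ∪ C) + n) (x : ℝ) :
    subsetExpansion r E (insert e C) x = subsetExpansion r E C x := by
  unfold subsetExpansion
  refine Finset.sum_congr rfl fun A hA ↦ ?_
  rw [Finset.union_insert, Finset.union_insert, h _ subset_rfl, h _ (Finset.mem_powerset.1 hA)]
  congr 2
  omega

/-- Deleting a loop and contracting it have the same value, and the recursion subtracts one from the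
other. -/
theorem subsetExpansion_eq_zero (hr : IsRankFunction r) {e : α} {E C : Finset α} (he : e ∈ E)
    (hl : r (insert e C) = r C) (x : ℝ) : subsetExpansion r E C x = 0 := by
  have h (A : Finset α) : r (insert e (A ∪ C)) = r (A ∪ C) + 0 :=
    hr.insert_eq_of_subset Finset.subset_union_right hl
  rw [← Finset.insert_erase he, subsetExpansion_insert hr (Finset.notMem_erase _ _), h,
    subsetExpansion_insert_right_eq fun A _ ↦ h A]
  simp

/-- If the members of a minor-closed class that are simple and not empty have cocircuits with fewer
than `x` elements, then the characteristic polynomials of the loopless members are positive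
at `x`. -/
theorem subsetExpansion_pos (hr : IsRankFunction r) (Q : Finset α → Finset α → Prop)
    (hdel : ∀ e E C, e ∉ E → Q (insert e E) C → Q E C)
    (hcon : ∀ e E C, e ∉ E → Q (insert e E) C → Q E (insert e C)) (x : ℝ)
    (hcoc : ∀ E C, Q E C → E.Nonempty → (∀ e ∈ E, r C < r (insert e C)) →
      (∀ e ∈ E, ∀ f ∈ E, e ≠ f → r (insert e C) < r (insert f (insert e C))) →
      ∃ H ⊆ E, r (H ∪ C) < r (E ∪ C) ∧
        (∀ e ∈ E, e ∉ H → r (insert e (H ∪ C)) = r (E ∪ C)) ∧ ((E \ H).card : ℝ) < x)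
    (E C : Finset α) (hQ : Q E C) (hl : ∀ e ∈ E, r C < r (insert e C)) :
    0 < subsetExpansion r E C x := by
  induction hn : E.card using Nat.strong_induction_on generalizing E C with
  | _ n ih =>
  subst hn
  have nonneg (E' C' : Finset α) (hc : E'.card < E.card) (hQ' : Q E' C') :
      0 ≤ subsetExpansion r E' C' x := by
    by_cases hl' : ∀ e ∈ E', r C' < r (insert e C')
    · exact (ih _ hc _ _ hQ' hl' rfl).le
    · push Not at hl'
      obtain ⟨e, he, h⟩ := hl'
      rw [subsetExpansion_eq_zero hr he (h.antisymm (hr.mono (Finset.subset_insert _ _)))]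
  have mono (S : Finset α) : ∀ E' C', Q (E' ∪ S) C' → Q E' C' := by
    induction S using Finset.induction with
    | empty => simp
    | insert e S heS ihS =>
      intro E' C' h
      rw [Finset.union_insert] at h
      by_cases he : e ∈ E' ∪ S
      · exact ihS _ _ (by rwa [Finset.insert_eq_of_mem he] at h)
      · exact ihS _ _ (hdel _ _ _ he h)
  rcases E.eq_empty_or_nonempty with rfl | hne
  · simp [subsetExpansion]
  by_cases hp : ∀ e ∈ E, ∀ f ∈ E, e ≠ f → r (insert e C) < r (insert f (insert e C))
  · obtain ⟨H, hHE, hlt, hH, hx⟩ := hcoc E C hQ hne hl hp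
    have hQH : Q H C := mono (E \ H) _ _ (by rwa [Finset.union_sdiff_of_subset hHE])
    have hHc : H.card < E.card := Finset.card_lt_card <| hHE.ssubset_of_ne <| by
      rintro rfl; exact hlt.false
    have hpos := ih _ hHc H C hQH (fun e he ↦ hl e (hHE he)) rfl
    have hcl (e : α) (he : e ∈ E) (heH : e ∉ H) (A : Finset α) (hA : A ⊆ H) :
        r (insert e (A ∪ C)) = r (A ∪ C) + 1 :=
      hr.insert_eq_succ_of_subset (Finset.union_subset_union_left hA) (by rwa [hH e he heH])
    -- deleting elements outside of `H` after contracting one of them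
    have step (e : α) (he : e ∈ E) (heH : e ∉ H) (S : Finset α) (hS : S ⊆ E) (hSH : Disjoint S H)
        (heS : e ∉ S) : subsetExpansion r (H ∪ S) (insert e C) x ≤ subsetExpansion r H C x := by
      induction S using Finset.induction with
      | empty =>
        rw [Finset.union_empty, subsetExpansion_insert_right_eq (hcl e he heH)]
      | insert f S hfS ihS =>
        rw [Finset.insert_subset_iff] at hS
        rw [Finset.disjoint_insert_left] at hSH
        rw [Finset.mem_insert, not_or] at heS
        have hf : f ∉ H ∪ S := by simp [hfS, hSH.1]
        have hee : e ∉ H ∪ S := by simp [heS.2, heH]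
        have hsub : insert e (insert f (H ∪ S)) ⊆ E := by
          simp [Finset.insert_subset_iff, Finset.union_subset_iff, *]
        have hQ' : Q (insert e (insert f (H ∪ S))) C :=
          mono E _ _ (by rwa [Finset.union_eq_right.2 hsub])
        have hQ2 : Q (H ∪ S) (insert f (insert e C)) := by
          refine hcon _ _ _ hf (hcon _ _ _ ?_ hQ')
          simp [heS.1, hee]
        have hc : (H ∪ S).card < E.card := by
          refine Finset.card_lt_card ((Finset.ssubset_iff_of_subset ?_).2 ⟨f, hS.1, hf⟩)
          exact Finset.union_subset hHE hS.2
        -- The hyperplane `H` together with `e` already spans, so `f` is not a coloop here.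
        have hfull : r (insert f (H ∪ S ∪ insert e C)) = r (H ∪ S ∪ insert e C) := by
          refine le_antisymm ?_ (hr.mono (Finset.subset_insert _ _))
          have h1 : r (insert f (H ∪ S ∪ insert e C)) ≤ r (E ∪ C) := by
            refine hr.mono ?_
            intro a ha
            simp only [Finset.mem_insert, Finset.mem_union] at ha ⊢
            rcases ha with rfl | (h | h) | rfl | h
            exacts [.inl hS.1, .inl (hHE h), .inl (hS.2 h), .inl he, .inr h]
          refine h1.trans ((hH e he heH).symm.le.trans (hr.mono ?_))
          intro a ha
          simp only [Finset.mem_insert, Finset.mem_union] at ha ⊢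
          tauto
        rw [Finset.union_insert, subsetExpansion_insert hr hf, hfull, Nat.sub_self, pow_zero,
          one_mul]
        -- Restoring `f` subtracts the value of a smaller minor, which is nonnegative by induction.
        have := nonneg _ _ hc hQ2
        have := ihS hS.2 hSH.2 heS.2
        linarith
    -- Each element of the cocircuit costs at most one copy of the value at `H`. The first is a
    -- coloop over `H`, the later ones are not.
    have key (S : Finset α) (hS : S ⊆ E) (hSH : Disjoint S H) (hSn : S.Nonempty) :
        (x - S.card) * subsetExpansion r H C x ≤ subsetExpansion r (H ∪ S) C x := by
      induction hSn using Finset.Nonempty.cons_induction with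
      | singleton e =>
        have he : e ∈ E := by simpa using hS
        have heH : e ∉ H := by simpa using hSH
        rw [Finset.union_comm, ← Finset.insert_eq, subsetExpansion_insert hr heH,
          subsetExpansion_insert_right_eq (hcl e he heH), hcl e he heH H subset_rfl]
        simp only [add_tsub_cancel_left, pow_one, Finset.card_singleton, Nat.cast_one]
        linarith
      | cons e S heS hSn ihS =>
        rw [Finset.cons_eq_insert] at hS hSH ⊢
        rw [Finset.insert_subset_iff] at hS
        rw [Finset.disjoint_insert_left] at hSH
        have hf : e ∉ H ∪ S := by simp [heS, hSH.1]
        have hfull : r (insert e (H ∪ S ∪ C)) = r (H ∪ S ∪ C) := by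
          obtain ⟨f, hf⟩ := hSn
          refine le_antisymm ?_ (hr.mono (Finset.subset_insert _ _))
          have h1 : r (insert e (H ∪ S ∪ C)) ≤ r (E ∪ C) := by
            refine hr.mono ?_
            intro a ha
            simp only [Finset.mem_insert, Finset.mem_union] at ha ⊢
            rcases ha with rfl | (h | h) | h
            exacts [.inl hS.1, .inl (hHE h), .inl (hS.2 h), .inr h]
          refine h1.trans ((hH f (hS.2 hf) (Finset.disjoint_left.1 hSH.2 hf)).symm.le.trans
            (hr.mono ?_))
          intro a ha
          simp only [Finset.mem_insert, Finset.mem_union] at ha ⊢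
          rcases ha with rfl | h | h <;> tauto
        have h1 := ihS hS.2 hSH.2
        have h2 := step e hS.1 hSH.1 S hS.2 hSH.2 heS
        rw [Finset.union_insert, subsetExpansion_insert hr hf, hfull, Nat.sub_self, pow_zero,
          one_mul, Finset.card_insert_of_notMem heS]
        push_cast
        linarith
    have hne' : (E \ H).Nonempty := by
      rw [Finset.sdiff_nonempty]
      exact fun h ↦ (Finset.card_le_card h).not_gt hHc
    have := key (E \ H) Finset.sdiff_subset Finset.sdiff_disjoint hne'
    rw [Finset.union_sdiff_of_subset hHE] at this
    exact (mul_pos (sub_pos.2 hx) hpos).trans_le this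
  -- If `e` and `f` are parallel, contracting `e` turns `f` into a loop, so deleting `e` leaves the
  -- value unchanged.
  · push Not at hp
    obtain ⟨e, he, f, hf, hef, h⟩ := hp
    have hpar : r (insert f (insert e C)) = r (insert e C) :=
      h.antisymm (hr.mono (Finset.subset_insert _ _))
    have hpar' : r (insert e (insert f C)) = r (insert f C) := by
      have h1 := hl f hf
      have h2 := hr.insert_le e C
      have h3 := hr.mono (Finset.subset_insert e (insert f C))
      rw [Finset.insert_comm] at h3 ⊢
      omega
    have hE := Finset.insert_erase he
    have hfe : f ∈ E.erase e := Finset.mem_erase.2 ⟨hef.symm, hf⟩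
    have hfull : r (insert e (E.erase e ∪ C)) = r (E.erase e ∪ C) :=
      hr.insert_eq_of_subset (A := insert f C)
        (Finset.insert_subset (Finset.mem_union_left _ hfe) Finset.subset_union_right) hpar'
    rw [← hE, subsetExpansion_insert hr (Finset.notMem_erase _ _), hfull,
      subsetExpansion_eq_zero hr hfe hpar]
    simp only [tsub_self, pow_zero, one_mul, sub_zero]
    refine ih _ (Finset.card_erase_lt_of_mem he) _ _ (hdel e _ _ (Finset.notMem_erase _ _) ?_)
      (fun a ha ↦ hl a (Finset.mem_of_mem_erase ha)) rfl
    rwa [hE]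

end SubsetExpansion

/-! ### Components of a tree with one vertex removed. -/

section Graph

variable {V : Type*} {T : SimpleGraph V}

/-- The vertices `a` and `b` lie in a common component of `T - v`. -/
def ReachableAvoiding (T : SimpleGraph V) (v a b : V) : Prop :=
  ∃ (ha : a ∈ ({v}ᶜ : Set V)) (hb : b ∈ ({v}ᶜ : Set V)),
    (T.induce ({v}ᶜ : Set V)).Reachable ⟨a, ha⟩ ⟨b, hb⟩

namespace ReachableAvoiding

variable {a b c u v : V}

theorem ne_left (h : ReachableAvoiding T v a b) : a ≠ v := h.1

theorem refl (h : a ≠ v) : ReachableAvoiding T v a a := ⟨h, h, .rfl⟩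

theorem symm (h : ReachableAvoiding T v a b) : ReachableAvoiding T v b a :=
  let ⟨ha, hb, h⟩ := h; ⟨hb, ha, h.symm⟩

theorem trans (h : ReachableAvoiding T v a b) (h' : ReachableAvoiding T v b c) :
    ReachableAvoiding T v a c :=
  let ⟨ha, _, h⟩ := h; let ⟨_, hc, h'⟩ := h'; ⟨ha, hc, h.trans h'⟩

theorem of_adj (h : T.Adj a b) (ha : a ≠ v) (hb : b ≠ v) : ReachableAvoiding T v a b :=
  ⟨ha, hb, SimpleGraph.Adj.reachable (by simpa using h)⟩

/-- A walk from `a` to `v` is followed until just before it first meets `v`. -/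
theorem exists_adj (hT : T.Connected) (h : a ≠ v) :
    ∃ u, T.Adj u v ∧ ReachableAvoiding T v a u := by
  obtain ⟨p⟩ := hT.preconnected a v
  induction p with
  | nil => exact absurd rfl h
  | @cons a b v hab p ih =>
    by_cases hb : b = v
    · subst hb
      exact ⟨a, hab, refl h⟩
    · obtain ⟨u, hu, hbu⟩ := ih hb
      exact ⟨u, hu, (of_adj hab h hb).trans hbu⟩

/-- A component of `T - u` that misses `v` lies in the component of `u` in `T - v`. -/
theorem of_not (hT : T.Connected) (huv : u ≠ v) (hau : a ≠ u) (hav : a ≠ v)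
    (h : ¬ ReachableAvoiding T u a v) : ReachableAvoiding T v a u := by
  obtain ⟨p⟩ := hT.preconnected a u
  induction p with
  | nil => exact absurd rfl hau
  | @cons a b u hab p ih =>
    by_cases hb : b = u
    · subst hb
      exact of_adj hab hav huv
    · have h1 : ReachableAvoiding T u a b := of_adj hab hau hb
      have hbv : b ≠ v := by rintro rfl; exact h h1
      exact (of_adj hab hav hbv).trans (ih huv hb hbv fun h2 ↦ h (h1.trans h2))

/-- A walk that avoids `v` uses no edge at `v`. -/
theorem reachable_deleteEdge (h : ReachableAvoiding T v a b) (u : V) :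
    (T.deleteEdges {s(u, v)}).Reachable a b := by
  obtain ⟨ha, hb, h⟩ := h
  let f : T.induce ({v}ᶜ : Set V) →g T.deleteEdges {s(u, v)} :=
    ⟨Subtype.val, by
      rintro ⟨x, hx⟩ ⟨y, hy⟩ hxy
      simp only [mem_compl_iff, mem_singleton_iff] at hx hy
      simp only [SimpleGraph.comap_adj, Function.Embedding.subtype_apply] at hxy
      simp only [SimpleGraph.deleteEdges_adj, hxy, mem_singleton_iff, Sym2.eq_iff, true_and]
      rintro (⟨-, h⟩ | ⟨h, -⟩)
      exacts [hy h, hx h]⟩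
  exact h.map f

/-- In a forest, an edge `uv` separates its two sides. -/
theorem not_both (hT : T.IsAcyclic) (huv : T.Adj u v) (h : ReachableAvoiding T v a u) :
    ¬ ReachableAvoiding T u a v := by
  intro h'
  have hb := SimpleGraph.isAcyclic_iff_forall_adj_isBridge.1 hT huv
  rw [SimpleGraph.isBridge_iff] at hb
  refine hb ?_
  have h1 := h.reachable_deleteEdge u
  have h2 := h'.reachable_deleteEdge v
  rw [Sym2.eq_swap] at h2
  exact h1.symm.trans h2

end ReachableAvoiding

end Graph

/-! ### Node widths of minors, and a set of small rank containing a cocircuit. -/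

section NodeWidth

variable {α V : Type*}

/-- The elements of `E` that `τ` maps into the component `c` of `T - v`. -/
noncomputable def displayedFinset (T : SimpleGraph V) (τ : α → V) (E : Finset α) (v : V)
    (c : (T.induce ({v}ᶜ : Set V)).ConnectedComponent) : Finset α :=
  open Classical in E.filter fun e ↦ ∃ h : τ e ∈ ({v}ᶜ : Set V),
    (T.induce ({v}ᶜ : Set V)).connectedComponentMk ⟨τ e, h⟩ = c

variable {T : SimpleGraph V} {τ : α → V} {E : Finset α} {v : V}

theorem mem_displayedFinset {c : (T.induce ({v}ᶜ : Set V)).ConnectedComponent} {e : α} :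
    e ∈ displayedFinset T τ E v c ↔ e ∈ E ∧ ∃ h : τ e ∈ ({v}ᶜ : Set V),
      (T.induce ({v}ᶜ : Set V)).connectedComponentMk ⟨τ e, h⟩ = c := by
  simp [displayedFinset]

theorem eq_of_mem_displayedFinset {c d : (T.induce ({v}ᶜ : Set V)).ConnectedComponent} {e : α}
    (hc : e ∈ displayedFinset T τ E v c) (hd : e ∈ displayedFinset T τ E v d) : c = d := by
  rw [mem_displayedFinset] at hc hd
  obtain ⟨-, h, rfl⟩ := hc
  obtain ⟨-, h', rfl⟩ := hd
  rfl

open Classical in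
theorem displayedFinset_mk {a : V} (ha : a ∈ ({v}ᶜ : Set V)) :
    displayedFinset T τ E v ((T.induce ({v}ᶜ : Set V)).connectedComponentMk ⟨a, ha⟩) =
      E.filter fun e ↦ ReachableAvoiding T v (τ e) a := by
  ext e
  rw [mem_displayedFinset, Finset.mem_filter]
  exact and_congr_right fun _ ↦ ⟨fun ⟨h, h'⟩ ↦ ⟨h, ha, SimpleGraph.ConnectedComponent.exact h'⟩,
    fun ⟨h, _, h'⟩ ↦ ⟨h, SimpleGraph.ConnectedComponent.sound h'⟩⟩

variable [DecidableEq α] {r : Finset α → ℕ} {C : Finset α}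

/-- The rank defect of `B` in the minor on `E` obtained by contracting `C`. -/
def minorRankDefect (r : Finset α → ℕ) (E C B : Finset α) : ℤ :=
  (r (E ∪ C) : ℤ) - r ((E \ B) ∪ C)

/-- The node width of `v` in the minor on `E` obtained by contracting `C`. -/
noncomputable def minorNodeWidth (r : Finset α → ℕ) (T : SimpleGraph V) (τ : α → V)
    (E C : Finset α) (v : V) : ℤ :=
  (r (E ∪ C) : ℤ) - r C - ∑ᶠ c, minorRankDefect r E C (displayedFinset T τ E v c)

theorem displayedFinset_insert_sdiff {c : (T.induce ({v}ᶜ : Set V)).ConnectedComponent} {e : α}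
    (he : e ∉ E) :
    (e ∈ displayedFinset T τ (insert e E) v c ∧
      insert e E \ displayedFinset T τ (insert e E) v c = E \ displayedFinset T τ E v c) ∨
    (e ∉ displayedFinset T τ (insert e E) v c ∧
      insert e E \ displayedFinset T τ (insert e E) v c =
        insert e (E \ displayedFinset T τ E v c)) := by
  by_cases h : e ∈ displayedFinset T τ (insert e E) v c
  · refine .inl ⟨h, ?_⟩
    ext a
    by_cases ha : a = e
    · subst ha; simp [h, he]
    · simp [mem_displayedFinset, ha]
  · refine .inr ⟨h, ?_⟩
    ext a
    by_cases ha : a = e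
    · subst ha; simp [h]
    · simp [mem_displayedFinset, ha]

theorem minorRankDefect_nonneg (hr : IsRankFunction r) (B : Finset α) :
    0 ≤ minorRankDefect r E C B := by
  have := hr.mono (Finset.union_subset_union_left (t := C) (Finset.sdiff_subset (s := E) (t := B)))
  unfold minorRankDefect
  omega

/-- Comparison of two sums whose terms are ordered up to an error `δ` in at most one place. -/
theorem finsum_le_finsum_add {ι : Type*} [Finite ι] {f g : ι → ℤ} {p : ι → Prop} {δ : ℤ}
    (hδ : 0 ≤ δ) (hp : ∀ i j, p i → p j → i = j) (h1 : ∀ i, p i → f i ≤ g i + δ)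
    (h2 : ∀ i, ¬ p i → f i ≤ g i) : ∑ᶠ i, f i ≤ ∑ᶠ i, g i + δ := by
  classical
  have := Fintype.ofFinite ι
  rw [finsum_eq_sum_of_fintype, finsum_eq_sum_of_fintype]
  calc ∑ i, f i ≤ ∑ i, (g i + if p i then δ else 0) := by
        refine Finset.sum_le_sum fun i _ ↦ ?_
        split_ifs with h
        · exact h1 i h
        · simpa using h2 i h
    _ = ∑ i, g i + ((Finset.univ.filter p).card : ℤ) * δ := by
        rw [Finset.sum_add_distrib, ← Finset.sum_filter, Finset.sum_const, nsmul_eq_mul]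
    _ ≤ ∑ i, g i + δ := by
        have : (Finset.univ.filter p).card ≤ 1 :=
          Finset.card_le_one.2 fun i hi j hj ↦ hp i j (by simpa using hi) (by simpa using hj)
        have : ((Finset.univ.filter p).card : ℤ) ≤ 1 := by exact_mod_cast this
        nlinarith

/-- The rank of the minor falls by `δ = r (insert e C) - r C`. Only the component holding `e`, if
any, can lose defect, and it loses at most `δ`. -/
theorem minorNodeWidth_contract_le [Finite V] (hr : IsRankFunction r) {e : α} (he : e ∉ E) :
    minorNodeWidth r T τ E (insert e C) v ≤ minorNodeWidth r T τ (insert e E) C v := by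
  have h := finsum_le_finsum_add (δ := (r (insert e C) : ℤ) - r C)
    (f := fun c ↦ minorRankDefect r (insert e E) C (displayedFinset T τ (insert e E) v c))
    (g := fun c ↦ minorRankDefect r E (insert e C) (displayedFinset T τ E v c))
    (p := fun c ↦ e ∈ displayedFinset T τ (insert e E) v c)
    (by have := hr.mono (Finset.subset_insert e C); omega)
    (fun c d ↦ eq_of_mem_displayedFinset)
    (fun c hc ↦ by
      rcases displayedFinset_insert_sdiff (T := T) (τ := τ) (v := v) (c := c) he with
        ⟨-, h⟩ | ⟨h, -⟩
      · have := hr.insert_add_le e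
          (Finset.subset_union_right (s₁ := E \ displayedFinset T τ E v c) (s₂ := C))
        simp only [minorRankDefect, h, Finset.insert_union, Finset.union_insert]
        omega
      · exact absurd hc h)
    (fun c hc ↦ by
      rcases displayedFinset_insert_sdiff (T := T) (τ := τ) (v := v) (c := c) he with
        ⟨h, -⟩ | ⟨-, h⟩
      · exact absurd h hc
      · simp only [minorRankDefect, h, Finset.insert_union, Finset.union_insert]
        omega)
  simp only [minorNodeWidth, Finset.insert_union, Finset.union_insert] at h ⊢
  omega

/-- The rank of the minor and the defect of the component holding `e`, if any, fall by the same
amount. By submodularity no other defect decreases. -/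
theorem minorNodeWidth_delete_le [Finite V] (hr : IsRankFunction r) {e : α} (he : e ∉ E) :
    minorNodeWidth r T τ E C v ≤ minorNodeWidth r T τ (insert e E) C v := by
  have h := finsum_le_finsum_add (δ := (r (insert e (E ∪ C)) : ℤ) - r (E ∪ C))
    (f := fun c ↦ minorRankDefect r (insert e E) C (displayedFinset T τ (insert e E) v c))
    (g := fun c ↦ minorRankDefect r E C (displayedFinset T τ E v c))
    (p := fun c ↦ e ∈ displayedFinset T τ (insert e E) v c)
    (by have := hr.mono (Finset.subset_insert e (E ∪ C)); omega)
    (fun c d ↦ eq_of_mem_displayedFinset)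
    (fun c hc ↦ by
      rcases displayedFinset_insert_sdiff (T := T) (τ := τ) (v := v) (c := c) he with
        ⟨-, h⟩ | ⟨h, -⟩
      · simp only [minorRankDefect, h, Finset.insert_union]
        omega
      · exact absurd hc h)
    (fun c hc ↦ by
      rcases displayedFinset_insert_sdiff (T := T) (τ := τ) (v := v) (c := c) he with
        ⟨h, -⟩ | ⟨-, h⟩
      · exact absurd h hc
      · have := hr.insert_add_le e (Finset.union_subset_union_left (t := C)
          (Finset.sdiff_subset (s := E) (t := displayedFinset T τ E v c)))
        simp only [minorRankDefect, h, Finset.insert_union]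
        omega)
  simp only [minorNodeWidth, Finset.insert_union] at h ⊢
  omega

/-- A minor of positive rank and of width at most `k` has a set of elements of rank at most `k` that
contains a cocircuit. -/
theorem exists_rank_le_of_minorNodeWidth_le [Finite V] (hr : IsRankFunction r) (hT : T.IsTree)
    {k : ℕ} (hk : ∀ v, minorNodeWidth r T τ E C v ≤ k) (hpos : r C < r (E ∪ C)) :
    ∃ X ⊆ E, r (X ∪ C) ≤ r C + k ∧ r ((E \ X) ∪ C) < r (E ∪ C) := by
  classical
  -- A pair `(v, w)` stands for the component of `w` in `T - v`; `S` selects those with positive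
  -- defect.
  let A (p : V × V) : Set V := {x | ReachableAvoiding T p.1 x p.2}
  let S : Set (V × V) := {p | p.2 ≠ p.1 ∧
    0 < minorRankDefect r E C (E.filter fun e ↦ τ e ∈ A p)}
  -- If all defects vanish, the node width of any vertex is the full rank, and `X = E` works.
  rcases S.eq_empty_or_nonempty with hS | hS
  · obtain ⟨v⟩ := hT.connected.nonempty
    refine ⟨E, subset_rfl, ?_, by simpa using hpos⟩
    have h0 : ∑ᶠ c, minorRankDefect r E C (displayedFinset T τ E v c) = 0 := by
      refine finsum_eq_zero_of_forall_eq_zero fun c ↦ ?_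
      induction c using SimpleGraph.ConnectedComponent.ind with
      | _ w =>
      obtain ⟨w, hw⟩ := w
      rw [displayedFinset_mk]
      refine le_antisymm (not_lt.1 fun h ↦ ?_) (minorRankDefect_nonneg hr _)
      exact (hS.subset (show (v, w) ∈ S from ⟨hw, h⟩)).elim
    have := hk v
    rw [minorNodeWidth, h0] at this
    omega
  · obtain ⟨⟨v, w⟩, ⟨hwv, hdef⟩, hmin⟩ :=
      Set.exists_min_image S (fun p ↦ (A p).ncard) S.toFinite hS
    simp only at hwv hdef hmin
    obtain ⟨u, huv, hwu⟩ := ReachableAvoiding.exists_adj hT.connected hwv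
    have hvu : v ∈ ({u}ᶜ : Set V) := huv.ne'
    let c₀ := (T.induce ({u}ᶜ : Set V)).connectedComponentMk ⟨v, hvu⟩
    -- Let `u` be the neighbour of `v` in the smallest selected component. Every component of `T -
    -- u` without `v` lies strictly inside it, since it misses `u`, so its defect is zero by
    -- minimality.
    have hsum : ∑ᶠ c, minorRankDefect r E C (displayedFinset T τ E u c) =
        minorRankDefect r E C (displayedFinset T τ E u c₀) := by
      refine finsum_eq_single _ c₀ fun c hc ↦ ?_
      induction c using SimpleGraph.ConnectedComponent.ind with
      | _ a =>
      obtain ⟨a, hau⟩ := a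
      rw [displayedFinset_mk]
      refine le_antisymm (not_lt.1 fun h ↦ ?_) (minorRankDefect_nonneg hr _)
      have hnr : ¬ ReachableAvoiding T u a v := fun ⟨_, _, h⟩ ↦
        hc (SimpleGraph.ConnectedComponent.eq.2 h)
      refine (hmin (u, a) ⟨hau, h⟩).not_gt (Set.ncard_lt_ncard ?_ (Set.toFinite _))
      refine ⟨fun x hx ↦ ?_, fun hsub ↦ (hsub (a := u) hwu.symm).ne_left rfl⟩
      have hxa : ReachableAvoiding T u x a := hx
      have hxv : ¬ ReachableAvoiding T u x v := fun h ↦ hnr (hxa.symm.trans h)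
      have hxnv : x ≠ v := by rintro rfl; exact hxv (.refl hxa.ne_left)
      exact (ReachableAvoiding.of_not hT.connected huv.ne hxa.ne_left hxnv hxv).trans hwu.symm
    -- With a single defect left, the node width of `u` is the rank of this set in the minor. Its
    -- complement lies on the side of `v`, outside the selected component, and so does not span.
    refine ⟨E \ displayedFinset T τ E u c₀, Finset.sdiff_subset, ?_, ?_⟩
    · have := hk u
      rw [minorNodeWidth, hsum, minorRankDefect] at this
      omega
    · have hle : r ((E \ (E \ displayedFinset T τ E u c₀)) ∪ C) ≤
          r ((E \ E.filter fun e ↦ τ e ∈ A (v, w)) ∪ C) := by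
        refine hr.mono (Finset.union_subset_union_left fun e he ↦ ?_)
        rw [Finset.mem_sdiff, Finset.mem_sdiff, not_and, not_not] at he
        replace he := he.2 he.1
        rw [displayedFinset_mk, Finset.mem_filter] at he
        simp only [Finset.mem_sdiff, Finset.mem_filter, he.1, true_and]
        intro h
        exact ReachableAvoiding.not_both hT.isAcyclic huv (ReachableAvoiding.trans h hwu) he.2
      unfold minorRankDefect at hdef
      omega

end NodeWidth

/-! ### Cocircuits of bounded rank over a finite field. -/

section Linear

variable {α : Type*} [DecidableEq α] {r : Finset α → ℕ} {K : Type*} [Field K] {W : Type*}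
  [AddCommGroup W] [Module K W] [FiniteDimensional K W] {v : α → W}

/-- A spanning-deficient set extends to a hyperplane. -/
theorem exists_hyperplane_superset (hr : IsRankFunction r) {E C Z : Finset α} (hZE : Z ⊆ E)
    (hZ : r (Z ∪ C) < r (E ∪ C)) :
    ∃ H, Z ⊆ H ∧ H ⊆ E ∧ r (H ∪ C) < r (E ∪ C) ∧
      ∀ e ∈ E, e ∉ H → r (insert e (H ∪ C)) = r (E ∪ C) := by
  let S := E.powerset.filter fun H ↦ Z ⊆ H ∧ r (H ∪ C) < r (E ∪ C)
  obtain ⟨H, hH, hmax⟩ := S.exists_max_image Finset.card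
    ⟨Z, by simp [S, hZE, hZ]⟩
  simp only [S, Finset.mem_filter, Finset.mem_powerset] at hH hmax
  refine ⟨H, hH.2.1, hH.1, hH.2.2, fun e he heH ↦ le_antisymm (hr.mono ?_) ?_⟩
  · exact Finset.insert_subset (Finset.mem_union_left _ he) (Finset.union_subset_union_left hH.1)
  · by_contra! hlt
    have := hmax (insert e H) ⟨Finset.insert_subset he hH.1,
      hH.2.1.trans (Finset.subset_insert _ _), by rwa [Finset.insert_union]⟩
    rw [Finset.card_insert_of_notMem heH] at this
    omega

theorem mem_span_image_iff (hrv : ∀ A : Finset α, r A = Module.finrank K (Submodule.span K (v '' A)))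
    {e : α} {A : Finset α} :
    v e ∈ Submodule.span K (v '' A) ↔ r (insert e A) ≤ r A := by
  rw [hrv, hrv, Finset.coe_insert, image_insert_eq]
  refine ⟨fun h ↦ (Submodule.span_insert_eq_span h ▸ le_rfl), fun h ↦ ?_⟩
  rw [Submodule.eq_of_le_of_finrank_le (Submodule.span_mono (subset_insert (v e) (v '' A))) h]
  exact Submodule.subset_span (mem_insert _ _)

/-- In a simple matroid over a field with `q` elements, a cocircuit of rank at most `k` has at most
`q ^ (k - 1)` elements. -/
theorem card_mul_card_sdiff_le [Finite K] (hr : IsRankFunction r)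
    (hrv : ∀ A : Finset α, r A = Module.finrank K (Submodule.span K (v '' A))) {k : ℕ}
    {E C X H : Finset α}
    (hsimple : ∀ e ∈ E, ∀ f ∈ E, e ≠ f → r (insert e C) < r (insert f (insert e C)))
    (hX : r (X ∪ C) ≤ r C + k) (hXH : E \ X ⊆ H) (hH : r (H ∪ C) < r (E ∪ C))
    (hHE : H ⊆ E) (hflat : ∀ e ∈ E, e ∉ H → r (insert e (H ∪ C)) = r (E ∪ C)) :
    Nat.card K * (E \ H).card ≤ Nat.card K ^ k := by
  rcases (E \ H).eq_empty_or_nonempty with h0 | ⟨e₀, he₀⟩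
  · simp [h0]
  have hq : 0 < Nat.card K := Nat.card_pos
  have := Module.finite_of_finite K (M := W)
  rw [Finset.mem_sdiff] at he₀
  -- The form `φ` vanishes on the hyperplane, hence at no element of the cocircuit: any such element
  -- together with `H ∪ C` spans `v e₀`.
  obtain ⟨φ, hφ₀, hφ⟩ := Submodule.exists_le_ker_of_notMem
    (show v e₀ ∉ Submodule.span K (v '' ↑(H ∪ C)) by
      rw [mem_span_image_iff hrv, not_le, hflat e₀ he₀.1 he₀.2]; exact hH)
  have hφne (e : α) (he : e ∈ E \ H) : φ (v e) ≠ 0 := by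
    rw [Finset.mem_sdiff] at he
    intro h
    have h1 : v e₀ ∈ Submodule.span K (v '' ↑(insert e (H ∪ C))) := by
      rw [mem_span_image_iff hrv, hflat e he.1 he.2]
      refine hr.mono ?_
      simp only [Finset.insert_subset_iff, Finset.mem_union, he.1, he₀.1, true_or, true_and]
      exact Finset.union_subset_union_left hHE
    refine hφ₀ ((Submodule.span_le.2 ?_ : _ ≤ LinearMap.ker φ) h1)
    rw [Finset.coe_insert, image_insert_eq, insert_subset_iff]
    exact ⟨h, Submodule.subset_span.trans hφ⟩
  set U := Submodule.span K (v '' (C : Set α)) with hU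
  set Y := Submodule.span K (v '' ↑(X ∪ C)) with hY
  have hUY : U ≤ Y := Submodule.span_mono (image_mono (by simp))
  have hUφ : U ≤ LinearMap.ker φ :=
    (Submodule.span_mono (image_mono (by simp))).trans hφ
  have hmemY (e : α) (he : e ∈ E \ H) : v e ∈ Y := by
    refine Submodule.subset_span (mem_image_of_mem _ ?_)
    rw [Finset.mem_sdiff] at he
    by_contra h
    simp only [Finset.coe_union, mem_union, Finset.mem_coe, not_or] at h
    exact he.2 (hXH (Finset.mem_sdiff.2 ⟨he.1, h.1⟩))
  have he₀' : e₀ ∈ E \ H := Finset.mem_sdiff.2 he₀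
  -- Scaling puts the cocircuit into the affine hyperplane `φ = 1`. Translates by `U` of differences
  -- from `w e₀` lie in `Y ⊓ ker φ`, and simplicity modulo `U` keeps them distinct.
  let w (e : α) : W := (φ (v e))⁻¹ • v e
  have hw (e : α) (he : e ∈ E \ H) : φ (w e) = 1 := by simp [w, hφne e he]
  have hwY (e : α) (he : e ∈ E \ H) : w e ∈ Y := Y.smul_mem _ (hmemY e he)
  let f : ↥(E \ H) × U → (Y ⊓ LinearMap.ker φ : Submodule K W) := fun p ↦
    ⟨w p.1 - w e₀ + p.2, by
      refine ⟨Y.add_mem (Y.sub_mem (hwY _ p.1.2) (hwY _ he₀')) (hUY p.2.2), ?_⟩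
      have : φ p.2 = 0 := hUφ p.2.2
      simp [hw _ p.1.2, hw _ he₀', this]⟩
  have hf : Function.Injective f := by
    rintro ⟨⟨a, ha⟩, x⟩ ⟨⟨b, hb⟩, y⟩ hab
    have h1 : w a - w e₀ + x = w b - w e₀ + y := congrArg Subtype.val hab
    by_cases h : a = b
    · subst h
      have : x = y := Subtype.ext (by simpa using h1)
      rw [this]
    · exfalso
      refine (hsimple a (Finset.mem_sdiff.1 ha).1 b (Finset.mem_sdiff.1 hb).1 h).not_ge ?_
      rw [← mem_span_image_iff hrv, Finset.coe_insert, image_insert_eq]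
      have h2 : v b = φ (v b) • ((φ (v a))⁻¹ • v a + (x - y)) := by
        have h3 : w b = (φ (v a))⁻¹ • v a + (x - y) := by
          have := congrArg (fun z ↦ z + w e₀ - y) h1
          calc w b = w b - w e₀ + y + w e₀ - y := by abel
            _ = w a - w e₀ + x + w e₀ - y := this.symm
            _ = w a + (x - y) := by abel
        rw [← h3]
        simp only [w]
        rw [smul_inv_smul₀ (hφne b hb)]
      rw [h2]
      refine Submodule.smul_mem _ _ (Submodule.add_mem _
        (Submodule.smul_mem _ _ (Submodule.subset_span (mem_insert _ _))) ?_)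
      exact Submodule.span_mono (subset_insert _ _) (U.sub_mem x.2 y.2)
  have hcard := Nat.card_le_card_of_injective f hf
  have hlt : Module.finrank K (Y ⊓ LinearMap.ker φ : Submodule K W) < Module.finrank K Y := by
    refine Submodule.finrank_lt_finrank_of_lt (lt_of_le_of_ne inf_le_left fun h ↦ hφ₀ ?_)
    exact (inf_eq_left.1 h) (hmemY _ he₀')
  rw [Nat.card_prod, Nat.card_eq_fintype_card, Fintype.card_coe,
    Module.natCard_eq_pow_finrank (K := K) (V := U),
    Module.natCard_eq_pow_finrank (K := K) (V := (Y ⊓ LinearMap.ker φ : Submodule K W))] at hcard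
  rw [hrv, hrv, ← hU, ← hY] at hX
  -- The kernel of `φ` lowers the dimension of `Y` by at least one, which pays for the extra factor
  -- `q`; the factor `|U|` cancels.
  refine Nat.le_of_mul_le_mul_right ?_ (pow_pos hq (Module.finrank K U))
  calc Nat.card K * (E \ H).card * Nat.card K ^ Module.finrank K U
      = Nat.card K * ((E \ H).card * Nat.card K ^ Module.finrank K U) := by ring
    _ ≤ Nat.card K * Nat.card K ^ Module.finrank K (Y ⊓ LinearMap.ker φ : Submodule K W) :=
        Nat.mul_le_mul_left _ hcard
    _ = Nat.card K ^ (Module.finrank K (Y ⊓ LinearMap.ker φ : Submodule K W) + 1) := by ring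
    _ ≤ Nat.card K ^ (k + Module.finrank K U) := Nat.pow_le_pow_right hq (by omega)
    _ = _ := pow_add _ _ _

/-- The bound on `x` is multiplied by `q` so that `k = 0` needs no truncated exponent. -/
theorem subsetExpansion_pos_of_minorNodeWidth_le [Finite K] (hr : IsRankFunction r)
    (hrv : ∀ A : Finset α, r A = Module.finrank K (Submodule.span K (v '' A))) {V : Type*}
    [Finite V] {T : SimpleGraph V} (hT : T.IsTree) (τ : α → V) {k : ℕ} {E C : Finset α}
    (hk : ∀ u, minorNodeWidth r T τ E C u ≤ k) (hl : ∀ e ∈ E, r C < r (insert e C)) {x : ℝ}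
    (hx : (Nat.card K : ℝ) ^ k < Nat.card K * x) : 0 < subsetExpansion r E C x := by
  refine subsetExpansion_pos hr (fun E C ↦ ∀ u, minorNodeWidth r T τ E C u ≤ k)
    (fun e E C he h u ↦ (minorNodeWidth_delete_le hr he).trans (h u))
    (fun e E C he h u ↦ (minorNodeWidth_contract_le hr he).trans (h u)) x ?_ E C hk hl
  intro E C hk hne hl hs
  obtain ⟨e, he⟩ := hne
  have hpos : r C < r (E ∪ C) := (hl e he).trans_le (hr.mono
    (Finset.insert_subset (Finset.mem_union_left _ he) Finset.subset_union_right))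
  obtain ⟨X, -, hX, hXE⟩ := exists_rank_le_of_minorNodeWidth_le hr hT hk hpos
  obtain ⟨H, hXH, hHE, hH, hflat⟩ := exists_hyperplane_superset hr Finset.sdiff_subset hXE
  refine ⟨H, hHE, hH, hflat, ?_⟩
  have h1 := card_mul_card_sdiff_le hr hrv hs hX hXH hH hHE hflat
  have h2 : (Nat.card K : ℝ) * (E \ H).card ≤ (Nat.card K : ℝ) ^ k := by exact_mod_cast h1
  have h3 : (0 : ℝ) < Nat.card K := by exact_mod_cast Nat.card_pos (α := K)
  exact lt_of_mul_lt_mul_left (h2.trans_lt hx) h3.le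

end Linear

/-! ### The rank function of a finite matroid. -/

variable {α : Type*}

theorem coe_natRk (M : Matroid α) [M.Finite] (X : Set α) : (M.natRk X : ℕ∞) = M.eRk X :=
  ENat.natCast_toNat (M.eRk_ne_top_iff.2 (M.isRkFinite_set X))

theorem natRk_closure (M : Matroid α) (X : Set α) : M.natRk (M.closure X) = M.natRk X := by
  rw [natRk, eRk_closure_eq, natRk]

theorem isRankFunction_natRk [DecidableEq α] (M : Matroid α) [M.Finite] :
    IsRankFunction fun A : Finset α ↦ M.natRk A where
  mono {A B} h := by
    have := M.eRk_mono (Finset.coe_subset.2 h)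
    rw [← coe_natRk, ← coe_natRk] at this
    exact_mod_cast this
  submodular A B := by
    have := M.eRk_inter_add_eRk_union_le A B
    simp only [← coe_natRk, ← Finset.coe_inter, ← Finset.coe_union] at this
    rw [add_comm]
    exact_mod_cast this
  insert_le e A := by
    have := M.eRk_insert_le_add_one e A
    simp only [← coe_natRk, ← Finset.coe_insert] at this
    exact_mod_cast this

theorem natRk_insert_empty [DecidableEq α] {M : Matroid α} {e : α} (he : M.IsNonloop e) :
    M.natRk ((insert e ∅ : Finset α) : Set α) = 1 := by
  rw [natRk, insert_empty_eq, Finset.coe_singleton, he.eRk_eq, ENat.toNat_one]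

theorem natRk_empty (M : Matroid α) : M.natRk ∅ = 0 := by
  rw [natRk, eRk_empty, ENat.toNat_zero]

/-! ### The characteristic polynomial as a sum over subsets. -/

section CharPoly

variable (M : Matroid α) [M.Finite]

/-- The flat spanned by a finite set. -/
def closureFlat (M : Matroid α) (A : Finset α) : M.FlatSet := ⟨M.closure A, M.isFlat_closure _⟩

/-- The Möbius function of the lattice of flats counts, with signs, the sets that span a flat. -/
theorem mu_eq_sum [DecidableEq α] [DecidableEq M.FlatSet] (h : M.Loopless) (F : M.FlatSet) :
    IncidenceAlgebra.mu ℝ (⟨∅, isFlat_empty_of_loopless h⟩ : M.FlatSet) F =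
      ∑ A ∈ M.ground_finite.toFinset.powerset with M.closureFlat A = F, (-1 : ℝ) ^ A.card := by
  set b : M.FlatSet := ⟨∅, isFlat_empty_of_loopless h⟩ with hb
  have hbot (F : M.FlatSet) : b ≤ F := Set.empty_subset F.1
  induction F using WellFoundedLT.induction with
  | _ F ih =>
  -- Summed over the flats below `F`, both sides give `1` if `F` is empty and `0` otherwise; by
  -- induction they agree below `F`, hence at `F`.
  have h1 := IncidenceAlgebra.sum_Icc_mu_right (𝕜 := ℝ) b F
  rw [← Finset.Ico_insert_right (hbot F), Finset.sum_insert (by simp)] at h1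
  rw [Finset.sum_congr rfl fun G hG ↦ ih G (Finset.mem_Ico.1 hG).2] at h1
  have h2 : ∑ G ∈ Finset.Icc b F, ∑ A ∈ M.ground_finite.toFinset.powerset with M.closureFlat A = G,
      (-1 : ℝ) ^ A.card = if b = F then 1 else 0 := by
    have hfin : F.1.Finite := M.ground_finite.subset F.2.subset_ground
    -- The sets of elements whose closure lies below `F` are exactly the subsets of `F`.
    have h3 : ∑ G ∈ Finset.Icc b F, ∑ A ∈ M.ground_finite.toFinset.powerset with M.closureFlat A = G,
        (-1 : ℝ) ^ A.card = ∑ A ∈ hfin.toFinset.powerset, (-1 : ℝ) ^ A.card := by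
      rw [← Finset.sum_fiberwise_of_maps_to (s := hfin.toFinset.powerset) (t := Finset.Icc b F)
        (g := M.closureFlat)]
      · refine Finset.sum_congr rfl fun G hG ↦ Finset.sum_congr ?_ fun _ _ ↦ rfl
        ext A
        simp only [Finset.mem_filter, Finset.mem_powerset]
        refine and_congr_left fun hA ↦ ⟨fun hAE ↦ ?_, fun hAF ↦ hAF.trans ?_⟩
        · have hAE' : (A : Set α) ⊆ M.E := by simpa using Finset.coe_subset.2 hAE
          have : (A : Set α) ⊆ F.1 := (M.subset_closure A hAE').trans
            (show M.closureFlat A ≤ F from hA ▸ (Finset.mem_Icc.1 hG).2)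
          intro a ha
          simpa using this ha
        · intro a ha
          simpa using F.2.subset_ground (by simpa using ha)
      · intro A hA
        rw [Finset.mem_Icc]
        refine ⟨hbot _, ?_⟩
        have : (A : Set α) ⊆ F.1 := by simpa using Finset.coe_subset.2 (Finset.mem_powerset.1 hA)
        exact (M.closure_subset_closure this).trans F.2.closure.subset
    rw [h3]
    have h4 := Finset.sum_powerset_neg_one_pow_card (x := hfin.toFinset)
    have h5 : (hfin.toFinset = ∅) ↔ b = F := by
      rw [Set.Finite.toFinset_eq_empty, hb, eq_comm, Subtype.ext_iff]
    simp only [h5] at h4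
    exact_mod_cast h4
  rw [← Finset.Ico_insert_right (hbot F), Finset.sum_insert (by simp)] at h2
  linarith

/-- Sets with the same closure have the same rank, so grouping subsets by closure produces the
Möbius coefficients. With a loop, both sides vanish. -/
theorem eval_charPoly [DecidableEq α] (x : ℝ) :
    M.charPoly.eval x =
      subsetExpansion (fun A : Finset α ↦ M.natRk A) M.ground_finite.toFinset ∅ x := by
  classical
  unfold charPoly
  split_ifs with h
  · have := Fintype.ofFinite M.FlatSet
    rw [finsum_eq_sum_of_fintype, Polynomial.eval_finsetSum]
    unfold subsetExpansion
    rw [← Finset.sum_fiberwise (g := M.closureFlat)]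
    refine Finset.sum_congr rfl fun F _ ↦ ?_
    have hmu := mu_eq_sum M h F
    rw [Polynomial.eval_mul, Polynomial.eval_C, Polynomial.eval_pow, Polynomial.eval_X]
    refine Eq.trans (congrArg (· * _) (Eq.trans ?_ hmu)) ?_
    · congr!
    · rw [Finset.sum_mul]
      refine Finset.sum_congr rfl fun A hA ↦ ?_
      simp only [Finset.union_empty, Finite.coe_toFinset]
      rw [← (Finset.mem_filter.1 hA).2, closureFlat, natRk_closure]
  · obtain ⟨e, he⟩ : M.loops.Nonempty := by
      rw [nonempty_iff_ne_empty]
      exact fun h0 ↦ h ⟨h0⟩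
    have he : M.IsLoop e := he
    rw [Polynomial.eval_zero, subsetExpansion_eq_zero M.isRankFunction_natRk (e := e)]
    · simpa using he.mem_ground
    · simp only [insert_empty_eq, Finset.coe_singleton, Finset.coe_empty, natRk, he.eRk_eq,
        eRk_empty]

end CharPoly

/-! ### Rank as the dimension of a span. -/

section Representation

variable {K : Type*} [Field K]

/-- A representation of a matroid computes its rank function, once the elements outside of the
ground set are represented by zero. -/
theorem natRk_eq_finrank {M : Matroid α} [M.Finite] {W : Type*} [AddCommGroup W] [Module K W]
    {v : α → W} (hv : ∀ I ⊆ M.E, M.Indep I ↔ LinearIndepOn K v I) (A : Set α) :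
    M.natRk A = Module.finrank K (Submodule.span K (M.E.indicator v '' A)) := by
  classical
  obtain ⟨I, hI⟩ := M.exists_isBasis' A
  have hIE := hI.indep.subset_ground
  have hli : LinearIndepOn K (M.E.indicator v) I := by
    have := (hv I hIE).1 hI.indep
    refine this.congr fun i hi ↦ ?_
    rw [indicator_of_mem (hIE hi)]
  have hspan : Submodule.span K (M.E.indicator v '' A) =
      Submodule.span K (M.E.indicator v '' I) := by
    refine le_antisymm (Submodule.span_le.2 ?_) (Submodule.span_mono (image_mono hI.subset))
    rintro _ ⟨a, ha, rfl⟩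
    by_cases haE : a ∈ M.E
    · by_contra hns
      have h1 : LinearIndepOn K (M.E.indicator v) (insert a I) := hli.insert hns
      have h2 : insert a I ⊆ M.E := insert_subset haE hIE
      have h3 : M.Indep (insert a I) := by
        rw [hv _ h2]
        refine h1.congr fun i hi ↦ ?_
        rw [indicator_of_mem (h2 hi)]
      have h4 := hI.mem_of_insert_indep ha h3
      exact hns (Submodule.subset_span (mem_image_of_mem _ h4))
    · rw [indicator_of_notMem haE]
      exact Submodule.zero_mem _
  have hIfin : I.Finite := M.ground_finite.subset hIE
  have := hIfin.fintype
  have hf := finrank_span_eq_card (R := K) (b := fun p : I ↦ M.E.indicator v p.1) hli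
  rw [hspan, image_eq_range, hf, natRk, ← hI.encard_eq_eRk, hIfin.encard_eq_coe_toFinset_card,
    ENat.toNat_natCast, toFinite_toFinset, toFinset_card]

theorem IsRepresentable.exists_natRk_eq_finrank {M : Matroid α} [M.Finite]
    (h : M.IsRepresentable K) : ∃ (n : ℕ) (v : α → Fin n → K), ∀ A : Finset α,
      M.natRk A = Module.finrank K (Submodule.span K (v '' A)) :=
  let ⟨n, v, hv⟩ := h
  ⟨n, M.E.indicator v, fun A ↦ natRk_eq_finrank hv A⟩

end Representation

/-! ### Tree-width as an attained minimum, and the positivity theorem. -/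

section TreeWidth

theorem TreeDecomp.nodeWidth_eq [DecidableEq α] {M : Matroid α} [M.Finite] (D : M.TreeDecomp)
    (v : D.V) : D.nodeWidth v = minorNodeWidth (fun A : Finset α ↦ M.natRk A) D.T D.τ
      M.ground_finite.toFinset ∅ v := by
  have h (c) : M.rankDefect (D.displayed v c) = minorRankDefect (fun A : Finset α ↦ M.natRk A)
      M.ground_finite.toFinset ∅ (displayedFinset D.T D.τ M.ground_finite.toFinset v c) := by
    have : D.displayed v c = (displayedFinset D.T D.τ M.ground_finite.toFinset v c : Set α) := by
      ext e
      simp [mem_displayedFinset, TreeDecomp.displayed]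
    simp [minorRankDefect, rankDefect, this]
  simp [TreeDecomp.nodeWidth, minorNodeWidth, h, natRk_empty]

/-- Deleting every element does not raise the width and ends at width zero. -/
theorem minorNodeWidth_nonneg [DecidableEq α] {r : Finset α → ℕ} (hr : IsRankFunction r)
    {V : Type*} [Finite V] (T : SimpleGraph V) (τ : α → V) (E C : Finset α) (v : V) :
    0 ≤ minorNodeWidth r T τ E C v := by
  induction E using Finset.induction with
  | empty => simp [minorNodeWidth, minorRankDefect]
  | insert e E he ih => exact ih.trans (minorNodeWidth_delete_le hr he)

theorem TreeDecomp.nodeWidth_le_width {M : Matroid α} (D : M.TreeDecomp) (v : D.V) :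
    D.nodeWidth v ≤ D.width :=
  have := D.finite_V
  le_ciSup (Set.finite_range _).bddAbove v

theorem TreeDecomp.width_nonneg {M : Matroid α} [M.Finite] (D : M.TreeDecomp) : 0 ≤ D.width := by
  classical
  have := D.finite_V
  obtain ⟨v⟩ := D.isTree.connected.nonempty
  refine le_trans ?_ (D.nodeWidth_le_width v)
  rw [D.nodeWidth_eq]
  exact minorNodeWidth_nonneg M.isRankFunction_natRk _ _ _ _ _

/-- Needed because the infimum in `ℤ` of a set unbounded below is only a default value. -/
theorem bddBelow_range_width (M : Matroid α) [M.Finite] :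
    BddBelow (range fun D : M.TreeDecomp ↦ D.width) :=
  ⟨0, by rintro _ ⟨D, rfl⟩; exact D.width_nonneg⟩

/-- The tree-decomposition whose tree has one vertex. -/
def TreeDecomp.trivial (M : Matroid α) : M.TreeDecomp where
  V := Unit
  finite_V := inferInstance
  T := ⊥
  isTree := SimpleGraph.IsTree.of_subsingleton
  τ := fun _ ↦ ()

theorem TreeDecomp.width_trivial (M : Matroid α) : (TreeDecomp.trivial M).width = M.natRk M.E := by
  have h (v : (TreeDecomp.trivial M).V) : (TreeDecomp.trivial M).nodeWidth v = M.natRk M.E := by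
    have : IsEmpty (((TreeDecomp.trivial M).T.induce
        ({v}ᶜ : Set (TreeDecomp.trivial M).V)).ConnectedComponent) := by
      refine ⟨fun c ↦ ?_⟩
      induction c using SimpleGraph.ConnectedComponent.ind with
      | _ w => exact w.2 rfl
    rw [TreeDecomp.nodeWidth, finsum_of_isEmpty, sub_zero]
  exact (iSup_congr h).trans (ciSup_const (ι := Unit))

theorem treeWidth_le_natRk (M : Matroid α) [M.Finite] : M.treeWidth ≤ M.natRk M.E :=
  (csInf_le M.bddBelow_range_width ⟨TreeDecomp.trivial M, rfl⟩).trans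
    (TreeDecomp.width_trivial M).le

theorem exists_width_eq_treeWidth (M : Matroid α) [M.Finite] :
    ∃ D : M.TreeDecomp, D.width = M.treeWidth :=
  have : Nonempty M.TreeDecomp := ⟨TreeDecomp.trivial M⟩
  Int.csInf_mem (range_nonempty _) M.bddBelow_range_width

/-- A loopless matroid of tree-width at most `k` that is representable over a field with `q`
elements has a characteristic polynomial that is positive above `q ^ (k - 1)`. -/
theorem IsRepresentable.eval_charPoly_pos {K : Type*} [Field K] [_root_.Finite K] {M : Matroid α}
    [M.Finite] (hM : M.IsRepresentable K) (hl : M.Loopless) {k : ℕ} (hk : M.treeWidth ≤ k) {x : ℝ}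
    (hx : (Nat.card K : ℝ) ^ k < Nat.card K * x) : 0 < M.charPoly.eval x := by
  classical
  obtain ⟨D, hD⟩ := M.exists_width_eq_treeWidth
  obtain ⟨n, v, hv⟩ := hM.exists_natRk_eq_finrank
  have := D.finite_V
  rw [eval_charPoly]
  refine subsetExpansion_pos_of_minorNodeWidth_le M.isRankFunction_natRk hv D.isTree D.τ
    (fun u ↦ ?_) (fun e he ↦ ?_) hx
  · rw [← D.nodeWidth_eq]
    exact (D.nodeWidth_le_width u).trans (hD.le.trans hk)
  · have he' : M.IsNonloop e := M.isNonloop_of_loopless (by simpa using he)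
    rw [natRk_insert_empty he', Finset.coe_empty, natRk_empty]
    exact one_pos

end TreeWidth

/-! ### The critical problem. -/

section CriticalProblem

variable {K : Type*} [Field K] {W : Type*} [AddCommGroup W] [Module K W]
  [FiniteDimensional K W]

theorem natCard_vanishing [Finite K] (S : Submodule K W) (m : ℕ) :
    Nat.card {F : Fin m → Module.Dual K W // ∀ i, F i ∈ S.dualAnnihilator} =
      (Nat.card K ^ m) ^ (Module.finrank K W - Module.finrank K S) := by
  rw [Nat.card_congr Equiv.subtypePiEquivPi, Nat.card_pi, Finset.prod_const, Finset.card_univ,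
    Fintype.card_fin]
  change Nat.card S.dualAnnihilator ^ m = _
  rw [Module.natCard_eq_pow_finrank (K := K), ← pow_mul, ← pow_mul, mul_comm]
  have := Subspace.finrank_add_finrank_dualAnnihilator_eq S
  congr 2
  omega

/-- The critical problem: at `q ^ m`, the characteristic polynomial of a family of vectors that
spans the space counts the `m`-tuples of linear forms that do not all vanish at any member of the
family. -/
theorem subsetExpansion_natCard_pow [DecidableEq α] [Finite K] {r : Finset α → ℕ} {v : α → W}
    (hrv : ∀ A : Finset α, r A = Module.finrank K (Submodule.span K (v '' A))) {E : Finset α}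
    (hE : r E = Module.finrank K W) (m : ℕ) :
    subsetExpansion r E ∅ ((Nat.card K : ℝ) ^ m) =
      Nat.card {F : Fin m → Module.Dual K W // ∀ e ∈ E, ∃ i, F i (v e) ≠ 0} := by
  classical
  have := Module.finite_of_finite K (M := Module.Dual K W)
  have := Fintype.ofFinite (Fin m → Module.Dual K W)
  -- Each power counts the `m`-tuples of forms that vanish on `A`.
  have hcard (A : Finset α) : ((Nat.card K : ℝ) ^ m) ^ (r E - r A) =
      ∑ F : Fin m → Module.Dual K W, if ∀ e ∈ A, ∀ i, F i (v e) = 0 then (1 : ℝ) else 0 := by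
    have h := natCard_vanishing (Submodule.span K (v '' A)) m
    rw [← hrv, ← hE] at h
    rw [Finset.sum_boole, ← Fintype.card_subtype, ← Nat.card_eq_fintype_card]
    have h' : Nat.card {F : Fin m → Module.Dual K W // ∀ e ∈ A, ∀ i, F i (v e) = 0} =
        (Nat.card K ^ m) ^ (r E - r A) := by
      rw [← h]
      refine Nat.card_congr (Equiv.subtypeEquivRight fun F ↦ ?_)
      have hann (i : Fin m) : F i ∈ (Submodule.span K (v '' A)).dualAnnihilator ↔ ∀ e ∈ A, F i (v e) = 0 := by
        rw [Submodule.mem_dualAnnihilator]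
        constructor
        · exact fun h e he ↦ h _ (Submodule.subset_span (mem_image_of_mem _ he))
        · intro h w hw
          have : Submodule.span K (v '' A) ≤ LinearMap.ker (F i) := by
            rw [Submodule.span_le]
            rintro _ ⟨e, he, rfl⟩
            exact h e he
          exact this hw
      simp only [hann]
      exact ⟨fun h i e he ↦ h e he i, fun h e he i ↦ h i e he⟩
    rw [h']
    push_cast
    rfl
  unfold subsetExpansion
  simp only [Finset.union_empty, hcard, Finset.mul_sum]
  rw [Finset.sum_comm, Nat.card_eq_fintype_card, Fintype.card_subtype, ← Finset.sum_boole]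
  refine Finset.sum_congr rfl fun F _ ↦ ?_
  -- Inclusion-exclusion: a tuple contributes the alternating sum over subsets of its common zeros
  -- in `E`, which is `0` unless there are none.
  have h1 := Finset.sum_powerset_neg_one_pow_card (x := E.filter fun e ↦ ∀ i, F i (v e) = 0)
  have h2 : (E.filter fun e ↦ ∀ i, F i (v e) = 0) = ∅ ↔ ∀ e ∈ E, ∃ i, F i (v e) ≠ 0 := by
    simp [Finset.filter_eq_empty_iff]
  simp only [mul_ite, mul_one, mul_zero]
  rw [← Finset.sum_filter]
  have h3 : (E.powerset.filter fun A ↦ ∀ e ∈ A, ∀ i, F i (v e) = 0) =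
      (E.filter fun e ↦ ∀ i, F i (v e) = 0).powerset := by
    ext A
    simp only [Finset.mem_filter, Finset.mem_powerset]
    exact ⟨fun h e he ↦ Finset.mem_filter.2 ⟨h.1 he, h.2 e he⟩,
      fun h ↦ ⟨fun e he ↦ (Finset.mem_filter.1 (h he)).1,
        fun e he ↦ (Finset.mem_filter.1 (h he)).2⟩⟩
  rw [h3]
  simp only [h2] at h1
  exact_mod_cast h1

end CriticalProblem

/-! ### Sharpness for projective geometries. -/

section ProjGeom

theorem exists_rep_mem {K : Type*} [Field K] {k : ℕ} (S : Submodule K (Fin k → K)) {w : Fin k → K} (hw : w ∈ S)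
    (h0 : w ≠ 0) : ∃ p : Projectivization K (Fin k → K), p.rep ∈ S := by
  obtain ⟨a, ha⟩ := Projectivization.exists_smul_eq_mk_rep K w h0
  exact ⟨Projectivization.mk K w h0, ha ▸ S.smul_mem _ hw⟩

variable (K : Type*) [Field K] [_root_.Finite K] (k : ℕ)

theorem projGeom_indep_iff (I : Set (Projectivization K (Fin k → K))) :
    (projGeom K k).Indep I ↔ LinearIndepOn K Projectivization.rep I := by
  change Projectivization.Independent (fun p : I ↦ (p : Projectivization K (Fin k → K))) ↔ _
  rw [Projectivization.independent_iff]
  rfl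

theorem projGeom_ground : (projGeom K k).E = univ := rfl

theorem isRepresentable_projGeom : (projGeom K k).IsRepresentable K :=
  ⟨k, Projectivization.rep, fun I _ ↦ projGeom_indep_iff K k I⟩

theorem loopless_projGeom : (projGeom K k).Loopless := by
  refine ⟨eq_empty_of_forall_notMem fun e he ↦ ?_⟩
  have he : (projGeom K k).IsLoop e := he
  refine he.dep.not_indep ((projGeom_indep_iff K k _).2 ?_)
  exact LinearIndepOn.singleton e.rep_nonzero

theorem natRk_projGeom (A : Set (Projectivization K (Fin k → K))) :
    (projGeom K k).natRk A =
      Module.finrank K (Submodule.span K (Projectivization.rep '' A)) := by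
  rw [natRk_eq_finrank (K := K) (v := Projectivization.rep) fun I _ ↦ projGeom_indep_iff K k I,
    projGeom_ground, indicator_univ]

theorem natRk_ground_projGeom : (projGeom K k).natRk (projGeom K k).E = k := by
  have : Submodule.span K (Projectivization.rep '' (projGeom K k).E) = ⊤ := by
    rw [eq_top_iff]
    intro w _
    by_cases h0 : w = 0
    · rw [h0]; exact Submodule.zero_mem _
    · obtain ⟨a, ha⟩ := Projectivization.exists_smul_eq_mk_rep K w h0
      rw [← inv_smul_smul a w, ha]
      exact Submodule.smul_mem _ (a⁻¹ : Kˣ).val (Submodule.subset_span ⟨_, mem_univ _, rfl⟩)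
  rw [natRk_projGeom, this, finrank_top, Module.finrank_fin_fun]

/-- The characteristic polynomial of `PG(k - 1, q)` vanishes at `q ^ m` for `m < k`. -/
theorem eval_charPoly_projGeom {m : ℕ} (hm : m < k) :
    (projGeom K k).charPoly.eval ((Nat.card K : ℝ) ^ m) = 0 := by
  classical
  rw [eval_charPoly, subsetExpansion_natCard_pow (K := K) (W := Fin k → K)
    (r := fun A : Finset (Projectivization K (Fin k → K)) ↦ (projGeom K k).natRk A)
    (v := Projectivization.rep) (fun A ↦ natRk_projGeom K k A)]
  · rw [Nat.cast_eq_zero, Nat.card_eq_zero]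
    refine .inl ⟨fun ⟨F, hF⟩ ↦ ?_⟩
    -- Fewer than `k` forms on `K^k` share a nonzero zero, and its point lies in the geometry.
    have hker : LinearMap.ker (LinearMap.pi F) ≠ ⊥ :=
      LinearMap.ker_ne_bot_of_finrank_lt (by simpa using hm)
    obtain ⟨w, hw, hw0⟩ := Submodule.exists_mem_ne_zero_of_ne_bot hker
    obtain ⟨p, hp⟩ := exists_rep_mem _ hw hw0
    obtain ⟨i, hi⟩ := hF p (by simp [projGeom_ground])
    exact hi (congrFun hp i)
  · rw [Set.Finite.coe_toFinset, natRk_ground_projGeom, Module.finrank_fin_fun]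

theorem treeWidth_projGeom (hk : 1 ≤ k) : (projGeom K k).treeWidth = k := by
  refine le_antisymm ((treeWidth_le_natRk _).trans (by rw [natRk_ground_projGeom])) ?_
  by_contra! hlt
  have h1 : (projGeom K k).treeWidth ≤ (k - 1 : ℕ) := by omega
  have hq : (1 : ℝ) < Nat.card K := by exact_mod_cast Finite.one_lt_card (α := K)
  -- Width at most `k - 1` would force positivity at `q^(k-1)`, which is a root.
  have h2 := (isRepresentable_projGeom K k).eval_charPoly_pos (loopless_projGeom K k) h1
    (x := (Nat.card K : ℝ) ^ (k - 1)) (lt_mul_of_one_lt_left (by positivity) hq)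
  rw [eval_charPoly_projGeom K k (by omega)] at h2
  exact h2.false

end ProjGeom

end Matroid

theorem theorem1p3 (q k : ℕ) (hq : IsPrimePow q) (hk : 1 ≤ k)
    (K : Type*) [Field K] [Finite K] (hK : Nat.card K = q) :
    (∀ {α : Type*} (M : Matroid α) [M.Finite], M.IsRepresentable K → M.treeWidth ≤ k →
      M.charPoly = 0 ∨ ∀ x : ℝ, (q : ℝ) ^ (k - 1) < x → 0 < M.charPoly.eval x) ∧
    ((Matroid.projGeom K k).IsRepresentable K ∧
      (Matroid.projGeom K k).treeWidth = k ∧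
      (Matroid.projGeom K k).charPoly ≠ 0 ∧
      (Matroid.projGeom K k).charPoly.eval ((q : ℝ) ^ (k - 1)) = 0) := by
  subst hK
  have hq0 : (0 : ℝ) < Nat.card K := by exact_mod_cast Nat.card_pos (α := K)
  have key {x : ℝ} (hx : (Nat.card K : ℝ) ^ (k - 1) < x) :
      (Nat.card K : ℝ) ^ k < Nat.card K * x := by
    rw [← Nat.sub_add_cancel hk, pow_succ']
    exact mul_lt_mul_of_pos_left hx hq0
  refine ⟨fun {α} M _ hM htw ↦ ?_, Matroid.isRepresentable_projGeom K k,
    Matroid.treeWidth_projGeom K k hk, fun h0 ↦ ?_,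
    Matroid.eval_charPoly_projGeom K k (Nat.sub_lt hk one_pos)⟩
  · by_cases hl : M.Loopless
    · exact .inr fun x hx ↦ hM.eval_charPoly_pos hl htw (key hx)
    · exact .inl (dif_neg hl)
  -- The polynomial is not zero because it is positive at `q^(k-1) + 1`.
  · have h := (Matroid.isRepresentable_projGeom K k).eval_charPoly_pos
      (Matroid.loopless_projGeom K k) (Matroid.treeWidth_projGeom K k hk).le
      (key (lt_add_one _))
    rw [h0, Polynomial.eval_zero] at h
    exact h.false
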